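/- All graphs are finite, simple, undirected and have at least one vertex; $\operatorname{tw}(G)$ and $\operatorname{cw}(G)$ denote the treewidth and the clique-width of $G$. For a graph $G$ and $A \subseteq V(G)$ with complement $\overline{A} = V(G)\setminus A$, the cut $(A,\overline{A})$ is a *split* of $G$ if $|A| \ge 2$, $|\overline{A}| \ge 2$ and all vertices of $A$ that have a neighbour in $\overline{A}$ have the same neighbourhood in $\overline{A}$. Let $\operatorname{sm}(A) = 1$ if $(A,\overline{A})$ is a split of $G$, and otherwise let $\operatorname{sm}(A)$ be the maximum size of a matching in the bipartite graph formed by the edges of $G$ between $A$ and $\overline{A}$. A *branch decomposition* $(T,\delta)$ of $G$ is a tree $T$ of maximum degree at most $3$ with a bijection $\delta$ from the leaves of $T$ to $V(G)$ (the single node of a one-node tree counts as a leaf). Each edge $e$ of $T$ induces the cut of $G$ given by the leaves of the two components of $T-e$. The *sm-width* of $(T,\delta)$ is the maximum of $\operatorname{sm}(A)$ over the cuts $(A,\overline{A})$ induced by edges of $T$ ($0$ if $T$ has no edge), and $\operatorname{smw}(G)$ is the minimum sm-width over all branch decompositions of $G$. **Proposition.** 1. For every graph $G$, $\operatorname{smw}(G)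 \le \operatorname{tw}(G)+1$. 2. Consequently, every class of graphs of bounded treewidth has bounded sm-width. 3. Every class of graphs of bounded sm-width has bounded clique-width. -/

import Mathlib

universe u

namespace SmWidth

/-! ### Treewidth -/

/-- A tree decomposition of `G`: a finite tree whose nodes carry bags of vertices, such that both
ends of every edge lie in a common bag and, for each vertex, the nodes whose bags contain it induce
a connected (in particular nonempty) subgraph of the tree. -/
structure TreeDecomposition {V : Type u} (G : SimpleGraph V) where
  Node : Type
  finite_node : Finite Node
  tree : SimpleGraph Node
  isTree : tree.IsTree
  bag : Node → Finset V
  edge_mem : ∀ u v : V, G.Adj u v → ∃ t, u ∈ bag t ∧ v ∈ bag t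
  connected : ∀ v : V, (tree.induce {t | v ∈ bag t}).Connected

/-- Largest bag size minus one. (On a graph with at least one vertex some bag is nonempty, so an
empty bag, which counts `0` here, does not affect the maximum.) -/
noncomputable def TreeDecomposition.width {V : Type u} {G : SimpleGraph V}
    (D : TreeDecomposition G) : ℕ∞ :=
  ⨆ t : D.Node, (((D.bag t).card - 1 : ℕ) : ℕ∞)

noncomputable def treewidth {V : Type u} (G : SimpleGraph V) : ℕ∞ :=
  ⨅ D : TreeDecomposition G, D.width

/-! ### Branch decompositions over the vertex set and their widths -/

/-- A leaf of a tree: a node of degree at most one (degree zero occurs only in the one-node tree,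
whose single node counts as a leaf). -/
def IsLeaf {N : Type} (T : SimpleGraph N) (t : N) : Prop :=
  (T.neighborSet t).encard ≤ 1

/-- A branch decomposition of a graph with vertex set `V`: a finite tree of maximum degree at most
three together with a bijection from its leaves to `V`. -/
structure BranchDecomposition (V : Type u) where
  Node : Type
  finite_node : Finite Node
  tree : SimpleGraph Node
  isTree : tree.IsTree
  subcubic : ∀ t, (tree.neighborSet t).encard ≤ 3
  leafEquiv : {t : Node // IsLeaf tree t} ≃ V

/-- The vertices mapped from the leaves in the component of `T - ab` that contains `a`. -/
def BranchDecomposition.side {V : Type u} (D : BranchDecomposition V) (a b : D.Node) : Set V :=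
  {v | (D.tree.deleteEdges {s(a, b)}).Reachable a (D.leafEquiv.symm v : D.Node)}

/-- The `f`-width of a branch decomposition: the maximum of `f` over all cuts induced by edges of
the tree (each edge is taken in both orientations, giving `A` and its complement). -/
noncomputable def BranchDecomposition.width {V : Type u} (D : BranchDecomposition V)
    (f : Set V → ℕ∞) : ℕ∞ :=
  ⨆ (a : D.Node) (b : D.Node) (_ : D.tree.Adj a b), f (D.side a b)

/-- The minimum `f`-width over all branch decompositions. -/
noncomputable def cutWidth (V : Type u) (f : Set V → ℕ∞) : ℕ∞ :=
  ⨅ D : BranchDecomposition V, D.width f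

/-! ### The split-matching cut function -/

/-- Maximum number of edges of a matching in the bipartite graph of the edges of `G` between `A`
and its complement. -/
noncomputable def mm {V : Type u} (G : SimpleGraph V) (A : Set V) : ℕ∞ :=
  ⨆ (M : (G.between A Aᶜ).Subgraph) (_ : M.IsMatching), M.edgeSet.encard

/-- `(A, Aᶜ)` is a split of `G`: both sides have at least two vertices, and all vertices of `A` that
have a neighbour in `Aᶜ` have the same neighbourhood in `Aᶜ`. -/
def IsSplit {V : Type u} (G : SimpleGraph V) (A : Set V) : Prop :=
  2 ≤ A.encard ∧ 2 ≤ Aᶜ.encard ∧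
    ∀ u ∈ A, ∀ v ∈ A, (G.neighborSet u ∩ Aᶜ).Nonempty → (G.neighborSet v ∩ Aᶜ).Nonempty →
      G.neighborSet u ∩ Aᶜ = G.neighborSet v ∩ Aᶜ

open Classical in
noncomputable def sm {V : Type u} (G : SimpleGraph V) (A : Set V) : ℕ∞ :=
  if IsSplit G A then 1 else mm G A

/-- The split-matching-width of `G`. -/
noncomputable def smw {V : Type u} (G : SimpleGraph V) : ℕ∞ :=
  cutWidth V (sm G)

/-! ### Clique-width -/

/-- Clique-width expressions with `k` labels: create one vertex with label `i`; disjoint union; add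
all edges between vertices labelled `i` and vertices labelled `j`, for `i ≠ j`; relabel `i` to
`j`. -/
inductive CliqueExpr (k : ℕ) : Type
  | vertex (i : Fin k) : CliqueExpr k
  | union (e₁ e₂ : CliqueExpr k) : CliqueExpr k
  | join (i j : Fin k) (hij : i ≠ j) (e : CliqueExpr k) : CliqueExpr k
  | relabel (i j : Fin k) (e : CliqueExpr k) : CliqueExpr k

namespace CliqueExpr

/-- Vertex set of the labelled graph constructed by an expression. -/
def Verts {k : ℕ} : CliqueExpr k → Type
  | vertex _ => Unit
  | union e₁ e₂ => e₁.Verts ⊕ e₂.Verts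
  | join _ _ _ e => e.Verts
  | relabel _ _ e => e.Verts

/-- Labels of the labelled graph constructed by an expression. -/
def label {k : ℕ} : (e : CliqueExpr k) → e.Verts → Fin k
  | vertex i => fun _ => i
  | union e₁ e₂ => Sum.elim e₁.label e₂.label
  | join _ _ _ e => e.label
  | relabel i j e => fun x => if e.label x = i then j else e.label x

/-- Underlying graph of the labelled graph constructed by an expression. -/
def graph {k : ℕ} : (e : CliqueExpr k) → SimpleGraph e.Verts
  | vertex _ => (⊥ : SimpleGraph Unit)
  | union e₁ e₂ => SimpleGraph.sum e₁.graph e₂.graph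
  | join i j _ e => e.graph ⊔ SimpleGraph.fromRel (fun x y => e.label x = i ∧ e.label y = j)
  | relabel _ _ e => e.graph

end CliqueExpr

/-- The least number of labels of an expression that constructs `G` up to isomorphism. -/
noncomputable def cliqueWidth {V : Type u} (G : SimpleGraph V) : ℕ∞ :=
  ⨅ (k : ℕ) (_ : ∃ e : CliqueExpr k, Nonempty (e.graph ≃g G)), (k : ℕ∞)

/-! ### Boundedness on classes of graphs -/

/-- The parameter `p` is bounded on the class `𝒢` of finite nonempty graphs. -/
def BoundedOn (p : (V : Type u) → SimpleGraph V → ℕ∞) (𝒢 : (V : Type u) → SimpleGraph V → Prop) :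
    Prop :=
  ∃ k : ℕ, ∀ (V : Type u) [Finite V] [Nonempty V] (G : SimpleGraph V), 𝒢 V G → p V G ≤ k

end SmWidth

/-! Both comparisons pass through `Built P S`: the set `S` grows from singletons by binary disjoint
unions through sets satisfying `P`. For `S = Set.univ` this is a rooted form of a branch
decomposition whose cuts satisfy `P` (`Built.exists_branchDecomposition`,
`BranchDecomposition.built_univ`).

Treewidth: let all bags have at most `k + 1` vertices, and give each vertex a home node whose bag
contains it. At a node `t`, group the vertices by the branch at `t` containing their home; a vertex
with home `t` is a group by itself. An edge of `G` between two groups has an end in the bag of `t`,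
since otherwise both ends live in a single branch at `t`. So the bag covers every cut obtained by
merging groups, which bounds matchings across it by `k + 1`. Recursion over the branches builds the
whole vertex set.

Clique-width: if `sm G A ≤ k`, the vertices of `A` have at most `m = k + 2 ^ k + 1` neighbourhoods
outside `A`. Along a `Built` derivation one constructs the induced subgraphs, labelled by these
neighbourhoods. When `S` and `T` merge, adjacency between them depends only on the labels, so joins
add exactly the missing edges, and the new classes are unions of old ones. Three blocks of `m`
labels suffice. -/

namespace SmWidth

/-! ### Branches of a tree at a node -/

section Trees

variable {N : Type*} {T : SimpleGraph N} {a b c d n m : N}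

/-- The nodes on the side of `a` after deletion of the edge `ab`. -/
def branch (T : SimpleGraph N) (a b : N) : Set N :=
  {n | (T.deleteEdges {s(a, b)}).Reachable a n}

theorem self_mem_branch : a ∈ branch T a b := SimpleGraph.Reachable.refl a

theorem notMem_branch (hT : T.IsTree) (h : T.Adj a b) : b ∉ branch T a b :=
  SimpleGraph.isBridge_iff.1 (SimpleGraph.isAcyclic_iff_forall_adj_isBridge.1 hT.isAcyclic h)

theorem mem_branch_or_mem_branch (hT : T.IsTree) (a b n : N) :
    n ∈ branch T a b ∨ n ∈ branch T b a := by
  obtain ⟨p⟩ := hT.connected.preconnected n a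
  induction p with
  | nil => exact .inl self_mem_branch
  | @cons u v w h p ih =>
    by_cases he : s(v, u) = s(w, b)
    · rcases Sym2.eq_iff.1 he with ⟨rfl, rfl⟩ | ⟨rfl, rfl⟩
      · exact .inr self_mem_branch
      · exact .inl self_mem_branch
    · have he' : s(v, u) ≠ s(b, w) := by rwa [Sym2.eq_swap (a := b)]
      refine ih.imp (fun hv => hv.trans ?_) (fun hv => hv.trans ?_)
      · exact SimpleGraph.Adj.reachable (SimpleGraph.deleteEdges_adj.2 ⟨h.symm, he⟩)
      · exact SimpleGraph.Adj.reachable (SimpleGraph.deleteEdges_adj.2 ⟨h.symm, he'⟩)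

theorem exists_isPath_cons (hT : T.IsTree) (h : T.Adj a c) (hn : n ∈ branch T c a) :
    ∃ p : T.Walk c n, (SimpleGraph.Walk.cons h p).IsPath := by
  classical
  obtain ⟨p, hp⟩ := hn.exists_isPath
  refine ⟨p.mapLe (SimpleGraph.deleteEdges_le _), ?_⟩
  rw [SimpleGraph.Walk.cons_isPath_iff]
  refine ⟨hp.mapLe _, fun ha => ?_⟩
  rw [SimpleGraph.Walk.support_mapLe_eq_support] at ha
  exact notMem_branch hT h.symm ⟨p.takeUntil a ha⟩

/-- The path from `a` to `n` is unique, and its second vertex is the neighbour of `a` whose branch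
contains `n`. -/
theorem branch_inj (hT : T.IsTree) (hc : T.Adj a c) (hd : T.Adj a d) (hnc : n ∈ branch T c a)
    (hnd : n ∈ branch T d a) : c = d := by
  obtain ⟨p, hp⟩ := exists_isPath_cons hT hc hnc
  obtain ⟨q, hq⟩ := exists_isPath_cons hT hd hnd
  have := (hT.isAcyclic.subsingleton_path a n).elim ⟨_, hp⟩ ⟨_, hq⟩
  simpa using congrArg (fun r => r.1.snd) this

theorem branch_compl (hT : T.IsTree) (h : T.Adj a b) : (branch T a b)ᶜ = branch T b a := by
  ext n
  refine ⟨fun hn => (mem_branch_or_mem_branch hT a b n).resolve_left hn, fun hb ha => ?_⟩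
  refine notMem_branch hT h (SimpleGraph.Reachable.trans ha ?_)
  rw [Sym2.eq_swap]
  exact SimpleGraph.Reachable.symm hb

theorem exists_mem_branch (hT : T.IsTree) (h : n ≠ a) : ∃ c, T.Adj a c ∧ n ∈ branch T c a := by
  obtain ⟨p, hp⟩ := (hT.connected.preconnected a n).exists_isPath
  cases p with
  | nil => exact absurd rfl h
  | @cons _ c _ hac p =>
    refine ⟨c, hac, ?_⟩
    rw [SimpleGraph.Walk.cons_isPath_iff] at hp
    refine ⟨p.toDeleteEdges _ fun e he => ?_⟩
    rintro rfl
    exact hp.2 (p.snd_mem_support_of_mem_edges he)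

theorem ne_of_mem_branch (hT : T.IsTree) (h : T.Adj a c) (hn : n ∈ branch T c a) : n ≠ a := by
  rintro rfl
  exact notMem_branch hT h.symm hn

theorem branch_subset (hT : T.IsTree) (hc : T.Adj a c) (hb : T.Adj a b) (hcb : c ≠ b) :
    branch T c a ⊆ branch T a b := fun n hn => by
  by_contra h
  have : n ∈ branch T b a := by rw [← branch_compl hT hb]; exact h
  exact hcb (branch_inj hT hc hb hn this)

theorem mem_branch_iff (hT : T.IsTree) (hb : T.Adj a b) :
    n ∈ branch T a b ↔ n = a ∨ ∃ c, T.Adj a c ∧ c ≠ b ∧ n ∈ branch T c a := by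
  constructor
  · intro hn
    by_cases hna : n = a
    · exact .inl hna
    · obtain ⟨c, hc, hnc⟩ := exists_mem_branch hT hna
      refine .inr ⟨c, hc, ?_, hnc⟩
      rintro rfl
      rw [← branch_compl hT hc] at hnc
      exact hnc hn
  · rintro (rfl | ⟨c, hc, hcb, hnc⟩)
    · exact self_mem_branch
    · exact branch_subset hT hc hb hcb hnc

/-- Induction over the oriented edges of a finite tree. -/
theorem branch_induction [Finite N] (hT : T.IsTree) {P : N → N → Prop}
    (h : ∀ a b, T.Adj a b → (∀ c, T.Adj a c → c ≠ b → P c a) → P a b) :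
    ∀ a b, T.Adj a b → P a b := by
  -- Induct on the size of the branch: the branches beyond `a` miss `a`, so they are strictly
  -- smaller.
  suffices H : ∀ (k : ℕ) (a b : N), T.Adj a b → (branch T a b).ncard = k → P a b from
    fun a b hab => H _ a b hab rfl
  intro k
  induction k using Nat.strong_induction_on with
  | _ k ih =>
    intro a b hab hk
    refine h a b hab fun c hac hcb => ih _ ?_ c a hac.symm rfl
    rw [← hk]
    refine Set.ncard_lt_ncard ⟨branch_subset hT hac hab hcb, fun hs => ?_⟩ (Set.toFinite _)
    exact notMem_branch hT hac.symm (hs self_mem_branch)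

/-- A connected set of nodes that avoids `t` lies in one branch at `t`. -/
theorem mem_branch_iff_of_connected {s : Set N} (hs : (T.induce s).Connected) (ha : a ∉ s)
    (hn : n ∈ s) (hm : m ∈ s) : n ∈ branch T c a ↔ m ∈ branch T c a := by
  have key : (T.deleteEdges {s(c, a)}).Reachable n m := by
    let f : T.induce s →g T.deleteEdges {s(c, a)} :=
      { toFun := Subtype.val
        map_rel' := by
          rintro ⟨x, hx⟩ ⟨y, hy⟩ hxy
          rw [SimpleGraph.deleteEdges_adj]
          refine ⟨hxy, fun he => ?_⟩
          rcases Sym2.eq_iff.1 (Set.mem_singleton_iff.1 he) with ⟨-, rfl⟩ | ⟨rfl, -⟩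
          · exact ha hy
          · exact ha hx }
    exact (hs.preconnected ⟨n, hn⟩ ⟨m, hm⟩).map f
  exact ⟨fun h => h.trans key, fun h => h.trans key.symm⟩

end Trees

/-! ### Sets built up by binary disjoint unions -/

section Built

variable {V : Type u} {P : Set V → Prop}

/-- `Built P S`: the set `S` is obtained from singletons by binary disjoint unions, all the
intermediate sets having the property `P`. -/
inductive Built (P : Set V → Prop) : Set V → Prop
  | singleton (v : V) (hv : P {v}) : Built P {v}
  | union {S T : Set V} (hS : Built P S) (hT : Built P T) (hd : Disjoint S T) (hP : P (S ∪ T)) :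
      Built P (S ∪ T)

/-- The fibres are added one at a time, so every intermediate set is the preimage of a subset of
`J`. Empty fibres are skipped, because `Built` produces only nonempty sets. -/
theorem Built.preimage {ι : Type*} (κ : V → ι) {J : Set ι} (hJ : J.Finite)
    (h : ∀ j ∈ J, κ ⁻¹' {j} = ∅ ∨ Built P (κ ⁻¹' {j})) (hP : ∀ J' ⊆ J, P (κ ⁻¹' J')) :
    κ ⁻¹' J = ∅ ∨ Built P (κ ⁻¹' J) := by
  induction J, hJ using Set.Finite.induction_on with
  | empty => exact .inl rfl
  | @insert j J hj _ ih =>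
    have hPJ := hP _ subset_rfl
    rw [Set.insert_eq, Set.preimage_union] at hPJ ⊢
    rcases h j (Set.mem_insert j J) with h1 | h1 <;>
      rcases ih (fun i hi => h i (Set.mem_insert_of_mem j hi))
        (fun J' hJ' => hP J' (hJ'.trans (Set.subset_insert j J))) with h2 | h2
    · exact .inl (by rw [h1, h2, Set.union_empty])
    · rw [h1, Set.empty_union]; exact .inr h2
    · rw [h2, Set.union_empty]; exact .inr h1
    · refine .inr (.union h1 h2 (Disjoint.preimage κ ?_) hPJ)
      simpa using hj

/-- A full binary tree, given by the set `F` of the addresses of its nodes, whose leaves are the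
addresses `g v` of the elements of `S`, such that the sets of leaves below a node satisfy `P`. -/
structure IsCoding (P : Set V → Prop) (S : Set V) (F : Set (List Bool)) (g : V → List Bool) :
    Prop where
  finite : F.Finite
  nil_mem : [] ∈ F
  parent_mem : ∀ x b, x ++ [b] ∈ F → x ∈ F
  sibling_mem : ∀ x b, x ++ [b] ∈ F → x ++ [!b] ∈ F
  map_mem : ∀ v ∈ S, g v ∈ F
  map_leaf : ∀ v ∈ S, ∀ b, g v ++ [b] ∉ F
  exists_map : ∀ x ∈ F, (∀ b, x ++ [b] ∉ F) → ∃ v ∈ S, g v = x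
  injOn : Set.InjOn g S
  prop : ∀ x ∈ F, P {v ∈ S | x <+: g v}

theorem isCoding_singleton (v : V) (hv : P {v}) : IsCoding P {v} {[]} (fun _ => []) where
  finite := Set.finite_singleton _
  nil_mem := rfl
  parent_mem x b h := by simp at h
  sibling_mem x b h := by simp at h
  map_mem _ _ := rfl
  map_leaf _ _ b := by simp
  exists_map x hx _ := ⟨v, rfl, hx.symm⟩
  injOn := by simp
  prop x hx := by
    obtain rfl : x = [] := hx
    simpa using hv

open Classical in
theorem IsCoding.union {S T : Set V} {F₁ F₂ : Set (List Bool)} {g₁ g₂ : V → List Bool}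
    (h₁ : IsCoding P S F₁ g₁) (h₂ : IsCoding P T F₂ g₂) (hd : Disjoint S T) (hP : P (S ∪ T)) :
    IsCoding P (S ∪ T) ({[]} ∪ (List.cons false '' F₁ ∪ List.cons true '' F₂))
      (fun v => if v ∈ S then false :: g₁ v else true :: g₂ v) := by
  have hT : ∀ v ∈ T, v ∉ S := fun v hv hv' => Set.disjoint_left.1 hd hv' hv
  constructor
  · exact (Set.finite_singleton _).union ((h₁.finite.image _).union (h₂.finite.image _))
  · simp
  · rintro (_ | ⟨_ | _, x⟩) b h
    · simp
    · exact .inr (.inl ⟨x, h₁.parent_mem x b (by simpa using h), rfl⟩)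
    · exact .inr (.inr ⟨x, h₂.parent_mem x b (by simpa using h), rfl⟩)
  · rintro (_ | ⟨_ | _, x⟩) b h
    · cases b
      · simpa using h₂.nil_mem
      · simpa using h₁.nil_mem
    · simpa using h₁.sibling_mem x b (by simpa using h)
    · simpa using h₂.sibling_mem x b (by simpa using h)
  · rintro v (hv | hv)
    · simpa [hv] using h₁.map_mem v hv
    · simpa [hT v hv] using h₂.map_mem v hv
  · rintro v (hv | hv) b
    · simpa [hv] using h₁.map_leaf v hv b
    · simpa [hT v hv] using h₂.map_leaf v hv b
  · rintro (_ | ⟨_ | _, x⟩) hx hb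
    · exact absurd (.inr (.inl ⟨[], h₁.nil_mem, rfl⟩)) (hb false)
    · obtain ⟨v, hv, rfl⟩ := h₁.exists_map x (by simpa using hx) (by simpa using hb)
      exact ⟨v, .inl hv, by simp [hv]⟩
    · obtain ⟨v, hv, rfl⟩ := h₂.exists_map x (by simpa using hx) (by simpa using hb)
      exact ⟨v, .inr hv, by simp [hT v hv]⟩
  · rintro v (hv | hv) w (hw | hw) hvw
    · exact h₁.injOn hv hw (by simpa [hv, hw] using hvw)
    · simp [hv, hT w hw] at hvw
    · simp [hw, hT v hv] at hvw
    · exact h₂.injOn hv hw (by simpa [hT v hv, hT w hw] using hvw)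
  · rintro (_ | ⟨_ | _, x⟩) hx
    · convert hP using 1
      ext v; simp
    · convert h₁.prop x (by simpa using hx) using 1
      ext v
      by_cases hv : v ∈ S <;> simp [hv]
    · convert h₂.prop x (by simpa using hx) using 1
      ext v
      by_cases hv : v ∈ S
      · simpa [hv] using fun hv' => absurd hv (hT v hv')
      · simp [hv]

theorem Built.exists_isCoding {S : Set V} (h : Built P S) : ∃ F g, IsCoding P S F g := by
  induction h with
  | singleton v hv => exact ⟨_, _, isCoding_singleton v hv⟩
  | union _ _ hd hP ih₁ ih₂ =>
    obtain ⟨_, _, h₁⟩ := ih₁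
    obtain ⟨_, _, h₂⟩ := ih₂
    exact ⟨_, _, h₁.union h₂ hd hP⟩

/-- The tree with the set `F` of addresses as node set. -/
def addressTree (F : Set (List Bool)) : SimpleGraph F where
  Adj x y := (∃ b, y.1 = x.1 ++ [b]) ∨ ∃ b, x.1 = y.1 ++ [b]
  symm := ⟨fun _ _ h => h.symm⟩
  loopless := ⟨fun x h => by
    rcases h with ⟨b, h⟩ | ⟨b, h⟩ <;> simpa using congrArg List.length h⟩

variable {F : Set (List Bool)}

/-- The only edge leaving the set of extensions of `y` joins `y` to its parent, and that edge is
deleted. -/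
theorem prefix_of_reachable {x y : F} {b : Bool} (hy : y.1 = x.1 ++ [b]) {z : F}
    (hz : ((addressTree F).deleteEdges {s(y, x)}).Reachable y z) : y.1 <+: z.1 := by
  suffices H : ∀ (u w : F), ((addressTree F).deleteEdges {s(y, x)}).Walk u w →
      y.1 <+: u.1 → y.1 <+: w.1 from hz.elim fun p => H _ _ p (List.prefix_refl _)
  intro u w p
  induction p with
  | nil => exact id
  | @cons u w _ h _ ih =>
    intro hu
    rw [SimpleGraph.deleteEdges_adj] at h
    obtain ⟨⟨c, hc⟩ | ⟨c, hc⟩, hne⟩ := h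
    · exact ih (hc ▸ hu.trans (List.prefix_append _ _))
    · rw [hc, List.prefix_concat_iff] at hu
      rcases hu with hu | hu
      · refine absurd ?_ hne
        have huy : u = y := Subtype.ext (hc.trans hu.symm)
        have hwx : w = x := Subtype.ext (by
          have := hu.symm.trans hy
          exact (List.append_inj' this rfl).1)
        rw [huy, hwx]; rfl
      · exact ih hu

theorem reachable_of_prefix (hF : ∀ x b, x ++ [b] ∈ F → x ∈ F) {x y : F} {b : Bool}
    (hy : y.1 = x.1 ++ [b]) (l : List Bool) : ∀ (hz : y.1 ++ l ∈ F),
    ((addressTree F).deleteEdges {s(y, x)}).Reachable y ⟨y.1 ++ l, hz⟩ := by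
  induction l using List.reverseRecOn with
  | nil => intro hz; convert SimpleGraph.Reachable.refl y; simp
  | append_singleton l c ih =>
    intro hz
    have hz' : (y.1 ++ l) ++ [c] ∈ F := by simpa using hz
    refine (ih (hF _ _ hz')).trans (SimpleGraph.Adj.reachable ?_)
    rw [SimpleGraph.deleteEdges_adj]
    refine ⟨.inl ⟨c, by simp⟩, fun he => ?_⟩
    rcases Sym2.eq_iff.1 (Set.mem_singleton_iff.1 he) with ⟨-, h2⟩ | ⟨h1, -⟩
    · have := congrArg (fun z : F => z.1.length) h2
      simp [hy] at this
    · have := congrArg (fun z : F => z.1.length) h1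
      simp [hy] at this

theorem mem_branch_addressTree (hF : ∀ x b, x ++ [b] ∈ F → x ∈ F) {x y z : F} {b : Bool}
    (hy : y.1 = x.1 ++ [b]) : z ∈ branch (addressTree F) y x ↔ y.1 <+: z.1 := by
  refine ⟨prefix_of_reachable hy, ?_⟩
  obtain ⟨z, hz⟩ := z
  rintro ⟨l, rfl⟩
  exact reachable_of_prefix hF hy l hz

theorem addressTree_isTree (h0 : [] ∈ F) (hF : ∀ x b, x ++ [b] ∈ F → x ∈ F) :
    (addressTree F).IsTree := by
  have hr : ∀ (l : List Bool) (hl : l ∈ F), (addressTree F).Reachable ⟨[], h0⟩ ⟨l, hl⟩ := by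
    intro l
    induction l using List.reverseRecOn with
    | nil => exact fun _ => SimpleGraph.Reachable.refl _
    | append_singleton l c ih =>
      exact fun hl => (ih (hF _ _ hl)).trans (SimpleGraph.Adj.reachable (.inl ⟨c, rfl⟩))
  have : Nonempty F := ⟨⟨[], h0⟩⟩
  refine ⟨⟨fun x y => (hr x.1 x.2).symm.trans (hr y.1 y.2)⟩, ?_⟩
  rw [SimpleGraph.isAcyclic_iff_forall_adj_isBridge]
  have key : ∀ x y : F, (∃ b, y.1 = x.1 ++ [b]) → (addressTree F).IsBridge s(y, x) := by
    rintro x y ⟨b, hy⟩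
    rw [SimpleGraph.isBridge_iff]
    intro hxy
    have := (prefix_of_reachable hy hxy).length_le
    simp [hy] at this
  rintro x y (h | h)
  · rw [Sym2.eq_swap]; exact key x y h
  · exact key y x h

theorem addressTree_subcubic (t : F) : ((addressTree F).neighborSet t).encard ≤ 3 := by
  rw [← Subtype.val_injective.encard_image]
  have : Subtype.val '' (addressTree F).neighborSet t ⊆
      {t.1.dropLast, t.1 ++ [false], t.1 ++ [true]} := by
    rintro _ ⟨s, ⟨b, hb⟩ | ⟨b, hb⟩, rfl⟩
    · cases b <;> simp [hb]
    · simp [hb]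
  calc _ ≤ _ := Set.encard_le_encard this
    _ ≤ ({t.1 ++ [false], t.1 ++ [true]} : Set (List Bool)).encard + 1 := Set.encard_insert_le _ _
    _ ≤ ({t.1 ++ [true]} : Set (List Bool)).encard + 1 + 1 := by
      gcongr; exact Set.encard_insert_le _ _
    _ = 3 := by rw [Set.encard_singleton]; norm_num

/-- Closure under siblings matters here: a root with a single child would have degree one and count
as a leaf. -/
theorem isLeaf_addressTree_iff (hF' : ∀ x b, x ++ [b] ∈ F → x ++ [!b] ∈ F) (t : F) :
    IsLeaf (addressTree F) t ↔ ∀ b, t.1 ++ [b] ∉ F := by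
  rw [IsLeaf, Set.encard_le_one_iff]
  constructor
  · intro h b hb
    have := h ⟨_, hb⟩ ⟨_, hF' _ _ hb⟩ (.inl ⟨_, rfl⟩) (.inl ⟨_, rfl⟩)
    simp at this
  · rintro h ⟨x, hx⟩ ⟨y, hy⟩ (⟨b, hb⟩ | ⟨b, hb⟩) (⟨c, hc⟩ | ⟨c, hc⟩)
    · exact absurd (hb ▸ hx) (h b)
    · exact absurd (hb ▸ hx) (h b)
    · exact absurd (hc ▸ hy) (h c)
    · exact Subtype.ext (List.append_inj' (hb.symm.trans hc) rfl).1

/-- An edge of the address tree cuts off the leaves below its lower end, so `P` is known for one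
orientation only. -/
theorem Built.exists_branchDecomposition (h : Built P Set.univ) :
    ∃ D : BranchDecomposition V, ∀ a b, D.tree.Adj a b → P (D.side a b) ∨ P (D.side a b)ᶜ := by
  obtain ⟨F, g, hc⟩ := h.exists_isCoding
  have hT := addressTree_isTree hc.nil_mem hc.parent_mem
  let e : V → {t : F // IsLeaf (addressTree F) t} := fun v =>
    ⟨⟨g v, hc.map_mem v trivial⟩,
      (isLeaf_addressTree_iff hc.sibling_mem _).2 (hc.map_leaf v trivial)⟩
  have he : Function.Bijective e := by
    refine ⟨fun v w hvw => hc.injOn trivial trivial ?_, ?_⟩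
    · exact congrArg (fun t => t.1.1) hvw
    · rintro ⟨t, ht⟩
      obtain ⟨v, -, hv⟩ := hc.exists_map t.1 t.2 ((isLeaf_addressTree_iff hc.sibling_mem _).1 ht)
      exact ⟨v, Subtype.ext (Subtype.ext hv)⟩
  let D : BranchDecomposition V :=
    { Node := F
      finite_node := hc.finite
      tree := addressTree F
      isTree := hT
      subcubic := addressTree_subcubic
      leafEquiv := (Equiv.ofBijective e he).symm }
  have hD : ∀ a b, D.side a b = {v | (e v).1 ∈ branch (addressTree F) a b} := fun _ _ => rfl
  have key : ∀ x y : F, (∃ b, y.1 = x.1 ++ [b]) → P (D.side y x) := by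
    rintro x y ⟨b, hy⟩
    convert hc.prop y.1 y.2 using 1
    rw [hD]
    ext v
    simpa using mem_branch_addressTree hc.parent_mem hy
  refine ⟨D, fun x y hxy => ?_⟩
  rcases hxy with h | h
  · right
    convert key x y h using 1
    rw [hD, hD, ← branch_compl hT (.inl h)]
    rfl
  · exact .inl (key y x h)

end Built

/-! ### Split-matching-width and treewidth -/

section Treewidth

variable {V : Type u} {G : SimpleGraph V}

/-- The edges of `G` leaving `X` are covered by at most `k` vertices. -/
def HasCutCover (G : SimpleGraph V) (k : ℕ) (X : Set V) : Prop :=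
  ∃ C : Finset V, C.card ≤ k ∧ ∀ u ∈ X, ∀ v ∉ X, G.Adj u v → u ∈ C ∨ v ∈ C

theorem HasCutCover.compl {k : ℕ} {X : Set V} (h : HasCutCover G k X) : HasCutCover G k Xᶜ := by
  obtain ⟨C, hC, h⟩ := h
  exact ⟨C, hC, fun u hu v hv huv => (h v (not_not.1 hv) u hu huv.symm).symm⟩

/-- Every matching edge contains a covering vertex, and different matching edges share no vertex. -/
theorem HasCutCover.mm_le {k : ℕ} {X : Set V} (h : HasCutCover G k X) : mm G X ≤ k := by
  obtain ⟨C, hC, h⟩ := h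
  refine iSup₂_le fun M hM => ?_
  have key : ∀ e : M.edgeSet, ∃ v ∈ C, v ∈ e.1 := by
    rintro ⟨e, he⟩
    induction e with
    | _ u v =>
      obtain ⟨huv, ⟨hu, hv⟩ | ⟨hu, hv⟩⟩ := M.adj_sub he
      · rcases h u hu v hv huv with h | h
        · exact ⟨u, h, by simp⟩
        · exact ⟨v, h, by simp⟩
      · rcases h v hv u hu huv.symm with h | h
        · exact ⟨v, h, by simp⟩
        · exact ⟨u, h, by simp⟩
  choose f hfC hf using key
  have hinj : Function.Injective fun e => (⟨f e, hfC e⟩ : C) := by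
    intro e e' hee
    have hee : f e = f e' := congrArg Subtype.val hee
    have h1 := hf e
    have h2 := hf e'
    rw [← hee] at h2
    obtain ⟨w, hw⟩ := h1
    obtain ⟨w', hw'⟩ := h2
    have a1 : M.Adj (f e) w := by rw [← SimpleGraph.Subgraph.mem_edgeSet, ← hw]; exact e.2
    have a2 : M.Adj (f e) w' := by rw [← SimpleGraph.Subgraph.mem_edgeSet, ← hw']; exact e'.2
    exact Subtype.ext (by rw [hw, hw', hM.eq_of_adj_left a1 a2])
  calc M.edgeSet.encard = ENat.card M.edgeSet := rfl
    _ ≤ ENat.card C := ENat.card_le_card_of_injective hinj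
    _ = C.card := by simp
    _ ≤ k := by exact_mod_cast hC

/-- The bound must be positive because a split has value `1` even if no edge crosses it. -/
theorem HasCutCover.sm_le {k : ℕ} {X : Set V} (h : HasCutCover G (k + 1) X) :
    sm G X ≤ (k + 1 : ℕ) := by
  unfold sm
  split_ifs
  · exact_mod_cast Nat.le_add_left 1 k
  · exact h.mm_le

theorem exists_branch_map {N : Type*} {T : SimpleGraph N} (hT : T.IsTree) (τ : V → N) (t : N) :
    ∃ κ : V → V ⊕ N, (∀ v, τ v = t → κ v = .inl v) ∧
      ∀ v, τ v ≠ t → ∃ c, T.Adj t c ∧ κ v = .inr c ∧ τ v ∈ branch T c t := by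
  classical
  choose f hf hf' using fun n (h : n ≠ t) => exists_mem_branch hT h
  refine ⟨fun v => if h : τ v = t then .inl v else .inr (f (τ v) h), fun v h => by simp [h],
    fun v h => ⟨_, hf _ h, by simp [h], hf' _ h⟩⟩

/-- Suppose adjacent `u`, `v` both avoid the bag of `t`. They share a bag at some node `s`, and the
nodes containing `u` form a connected set avoiding `t`, so the home of `u` lies in the branch of
`s`; likewise for `v`. Hence `κ u = κ v`, and no union of fibres separates them. -/
theorem TreeDecomposition.hasCutCover_preimage (D : TreeDecomposition G) {τ : V → D.Node}
    (hτ : ∀ v, v ∈ D.bag (τ v)) {t : D.Node} {κ : V → V ⊕ D.Node}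
    (h2 : ∀ v, τ v ≠ t → ∃ c, D.tree.Adj t c ∧ κ v = .inr c ∧ τ v ∈ branch D.tree c t)
    {k : ℕ} (hk : (D.bag t).card ≤ k) (J : Set (V ⊕ D.Node)) :
    HasCutCover G k (κ ⁻¹' J) := by
  refine ⟨D.bag t, hk, fun u hu v hv huv => ?_⟩
  by_contra! hn
  obtain ⟨s, hus, hvs⟩ := D.edge_mem u v huv
  have hne : ∀ w, w ∉ D.bag t → τ w ≠ t := fun w hw h => hw (h ▸ hτ w)
  obtain ⟨c, hc, hcu, hcu'⟩ := h2 u (hne u hn.1)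
  obtain ⟨d, hd, hdv, hdv'⟩ := h2 v (hne v hn.2)
  rw [mem_branch_iff_of_connected (D.connected u) hn.1 (hτ u) hus] at hcu'
  rw [mem_branch_iff_of_connected (D.connected v) hn.2 (hτ v) hvs] at hdv'
  have := branch_inj D.isTree hc hd hcu' hdv'
  apply hv
  rw [Set.mem_preimage, hdv, ← this, ← hcu]
  exact hu

theorem TreeDecomposition.built_preimage [Finite V] (D : TreeDecomposition G) {τ : V → D.Node}
    (hτ : ∀ v, v ∈ D.bag (τ v)) {t : D.Node} {κ : V → V ⊕ D.Node}
    (h1 : ∀ v, τ v = t → κ v = .inl v)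
    (h2 : ∀ v, τ v ≠ t → ∃ c, D.tree.Adj t c ∧ κ v = .inr c ∧ τ v ∈ branch D.tree c t)
    {k : ℕ} (hk : (D.bag t).card ≤ k) (J : Set (V ⊕ D.Node))
    (hJ : ∀ c, .inr c ∈ J → D.tree.Adj t c →
      τ ⁻¹' branch D.tree c t = ∅ ∨ Built (HasCutCover G k) (τ ⁻¹' branch D.tree c t)) :
    κ ⁻¹' J = ∅ ∨ Built (HasCutCover G k) (κ ⁻¹' J) := by
  have := D.finite_node
  have hP := D.hasCutCover_preimage hτ h2 hk
  refine Built.preimage κ J.toFinite ?_ fun J' _ => hP J'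
  rintro (v | c) hj
  · by_cases hv : τ v = t
    · have hpre : κ ⁻¹' {.inl v} = {v} := by
        ext w
        simp only [Set.mem_preimage, Set.mem_singleton_iff]
        refine ⟨fun hw => ?_, fun hw => hw ▸ h1 v hv⟩
        by_cases hwt : τ w = t
        · exact Sum.inl_injective ((h1 w hwt).symm.trans hw)
        · obtain ⟨c, -, hc, -⟩ := h2 w hwt
          simp [hc] at hw
      have := hP {.inl v}
      rw [hpre] at this ⊢
      exact .inr (.singleton v this)
    · refine .inl (Set.eq_empty_of_forall_notMem fun w hw => ?_)
      rw [Set.mem_preimage, Set.mem_singleton_iff] at hw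
      by_cases hwt : τ w = t
      · obtain rfl : w = v := Sum.inl_injective ((h1 w hwt).symm.trans hw)
        exact hv hwt
      · obtain ⟨c, -, hc, -⟩ := h2 w hwt
        simp [hc] at hw
  · by_cases hc : D.tree.Adj t c
    · have hpre : κ ⁻¹' {.inr c} = τ ⁻¹' branch D.tree c t := by
        ext w
        simp only [Set.mem_preimage, Set.mem_singleton_iff]
        constructor
        · intro hw
          by_cases hwt : τ w = t
          · simp [h1 w hwt] at hw
          · obtain ⟨d, -, hd, hwd⟩ := h2 w hwt
            rwa [← Sum.inr_injective (hd.symm.trans hw)]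
        · intro hw
          obtain ⟨d, htd, hd, hwd⟩ := h2 w (ne_of_mem_branch D.isTree hc hw)
          rw [hd, branch_inj D.isTree hc htd hw hwd]
      rw [hpre]
      exact hJ c hj hc
    · refine .inl (Set.eq_empty_of_forall_notMem fun w hw => ?_)
      rw [Set.mem_preimage, Set.mem_singleton_iff] at hw
      by_cases hwt : τ w = t
      · simp [h1 w hwt] at hw
      · obtain ⟨d, htd, hd, -⟩ := h2 w hwt
        exact hc (Sum.inr_injective (hd.symm.trans hw) ▸ htd)

theorem TreeDecomposition.built_branch [Finite V] (D : TreeDecomposition G) {k : ℕ}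
    (hk : ∀ t, (D.bag t).card ≤ k) {τ : V → D.Node} (hτ : ∀ v, v ∈ D.bag (τ v)) :
    ∀ a b, D.tree.Adj a b →
      τ ⁻¹' branch D.tree a b = ∅ ∨ Built (HasCutCover G k) (τ ⁻¹' branch D.tree a b) := by
  have := D.finite_node
  refine branch_induction D.isTree fun a b hab ih => ?_
  obtain ⟨κ, h1, h2⟩ := exists_branch_map D.isTree τ a
  -- Merging all groups at `a` except the one towards `b` gives the vertices with home in the branch
  -- of `a`.
  have := D.built_preimage hτ h1 h2 (hk a) {.inr b}ᶜ fun c hc hac =>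
    ih c hac fun h => hc (by rw [h]; rfl)
  convert this using 2 <;>
  · ext v
    rw [← branch_compl D.isTree hab.symm]
    simp only [Set.mem_preimage, Set.mem_compl_iff, Set.mem_singleton_iff]
    refine not_congr ⟨fun hv => ?_, fun hv => ?_⟩
    · obtain ⟨d, had, hd, hvd⟩ := h2 v (ne_of_mem_branch D.isTree hab hv)
      rw [hd, branch_inj D.isTree hab had hv hvd]
    · by_cases hva : τ v = a
      · simp [h1 v hva] at hv
      · obtain ⟨d, had, hd, hvd⟩ := h2 v hva
        rwa [← Sum.inr_injective (hd.symm.trans hv)]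

theorem TreeDecomposition.built_univ [Finite V] [Nonempty V] (D : TreeDecomposition G) {k : ℕ}
    (hk : ∀ t, (D.bag t).card ≤ k) : Built (HasCutCover G k) Set.univ := by
  have := D.finite_node
  have hτ : ∀ v, ∃ t, v ∈ D.bag t := fun v => by
    obtain ⟨t, ht⟩ := (D.connected v).nonempty
    exact ⟨t, ht⟩
  choose τ hτ using hτ
  obtain ⟨κ, h1, h2⟩ := exists_branch_map D.isTree τ (τ (Classical.arbitrary V))
  have := D.built_preimage hτ h1 h2 (hk _) Set.univ fun c _ hc =>
    D.built_branch hk hτ _ _ hc.symm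
  exact this.resolve_left (by simp)

theorem smw_le_of_built {k : ℕ} (h : Built (HasCutCover G (k + 1)) Set.univ) :
    smw G ≤ (k + 1 : ℕ) := by
  obtain ⟨D, hD⟩ := h.exists_branchDecomposition
  refine (iInf_le _ D).trans (iSup_le fun a => iSup_le fun b => iSup_le fun hab => ?_)
  refine HasCutCover.sm_le ((hD a b hab).elim id fun h => ?_)
  simpa using h.compl

theorem smw_le_treewidth_add_one [Finite V] [Nonempty V] (G : SimpleGraph V) :
    smw G ≤ treewidth G + 1 := by
  rw [treewidth, ENat.iInf_add]
  refine le_iInf fun D => ?_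
  by_cases hD : D.width = ⊤
  · simp [hD]
  obtain ⟨k, hk⟩ := ENat.ne_top_iff_exists.1 hD
  rw [← hk]
  refine (smw_le_of_built (k := k) (D.built_univ fun t => ?_)).trans (by simp)
  -- Truncated subtraction is harmless: an empty bag also has at most `k + 1` vertices.
  have h : (((D.bag t).card - 1 : ℕ) : ℕ∞) ≤ k := by
    rw [hk]
    exact le_iSup (fun t => (((D.bag t).card - 1 : ℕ) : ℕ∞)) t
  have := ENat.natCast_le_natCast.1 h
  omega

end Treewidth
/-! ### From branch decompositions to set families -/

section BranchDecomposition

variable {V : Type u} {P : Set V → Prop}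

theorem BranchDecomposition.mem_side (D : BranchDecomposition V) {a b : D.Node} {v : V} :
    v ∈ D.side a b ↔ (D.leafEquiv.symm v : D.Node) ∈ branch D.tree a b := Iff.rfl

/-- Away from `b`, the node `a` has at most two neighbours. Two give a disjoint union, one leaves
the set unchanged, and none makes `a` a leaf and the side a singleton. -/
theorem BranchDecomposition.built_side (D : BranchDecomposition V)
    (hP : ∀ a b, D.tree.Adj a b → P (D.side a b)) :
    ∀ a b, D.tree.Adj a b → Built P (D.side a b) := by
  have := D.finite_node
  refine branch_induction D.isTree fun a b hab ih => ?_
  have hPab := hP a b hab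
  by_cases hN : ∃ c, D.tree.Adj a c ∧ c ≠ b
  · obtain ⟨c, hac, hcb⟩ := hN
    have hleaf : ∀ v, (D.leafEquiv.symm v : D.Node) ≠ a := by
      rintro v rfl
      exact hcb (Set.encard_le_one_iff.1 (D.leafEquiv.symm v).2 _ _ hac hab)
    by_cases hN' : ∃ d, D.tree.Adj a d ∧ d ≠ b ∧ d ≠ c
    · obtain ⟨d, had, hdb, hdc⟩ := hN'
      have hall : ∀ e, D.tree.Adj a e → e ≠ b → e = c ∨ e = d := by
        intro e hae heb
        by_contra! hne
        have hsub : ({b, c, d, e} : Set D.Node) ⊆ D.tree.neighborSet a := by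
          rintro x (rfl | rfl | rfl | rfl) <;> assumption
        have h4 : ({b, c, d, e} : Set D.Node).encard = 4 := by
          rw [Set.encard_insert_of_notMem, Set.encard_insert_of_notMem, Set.encard_pair hne.2.symm]
          · norm_num
          · simp [hdc.symm, hne.1.symm]
          · simp [hcb.symm, hdb.symm, heb.symm]
        have := (Set.encard_le_encard hsub).trans (D.subcubic a)
        rw [h4] at this
        exact absurd this (by decide)
      have heq : D.side a b = D.side c a ∪ D.side d a := by
        ext v
        rw [Set.mem_union, D.mem_side, D.mem_side, D.mem_side, mem_branch_iff D.isTree hab]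
        constructor
        · rintro (h | ⟨e, hae, heb, he⟩)
          · exact absurd h (hleaf v)
          · rcases hall e hae heb with rfl | rfl
            · exact .inl he
            · exact .inr he
        · rintro (h | h)
          · exact .inr ⟨c, hac, hcb, h⟩
          · exact .inr ⟨d, had, hdb, h⟩
      rw [heq] at hPab ⊢
      refine .union (ih c hac hcb) (ih d had hdb) (Set.disjoint_left.2 fun v hc hd => ?_) hPab
      exact hdc (branch_inj D.isTree had hac hd hc)
    · push Not at hN'
      have heq : D.side a b = D.side c a := by
        ext v
        rw [D.mem_side, D.mem_side, mem_branch_iff D.isTree hab]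
        constructor
        · rintro (h | ⟨e, hae, heb, he⟩)
          · exact absurd h (hleaf v)
          · rwa [← hN' e hae heb]
        · exact fun h => .inr ⟨c, hac, hcb, h⟩
      rw [heq]
      exact ih c hac hcb
  · push Not at hN
    have hleaf : IsLeaf D.tree a := Set.encard_le_one_iff.2 fun x y hx hy =>
      (hN x hx).trans (hN y hy).symm
    have heq : D.side a b = {D.leafEquiv ⟨a, hleaf⟩} := by
      ext v
      rw [D.mem_side, mem_branch_iff D.isTree hab, Set.mem_singleton_iff, ← Equiv.symm_apply_eq,
        Subtype.ext_iff]
      constructor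
      · rintro (h | ⟨e, hae, heb, -⟩)
        · exact h
        · exact absurd (hN e hae) heb
      · exact .inl
    rw [heq] at hPab ⊢
    exact .singleton _ hPab

/-- Root the tree at a leaf: its edge splits the vertex set into a singleton and the rest. `hu` is
separate because the whole set need not be a side. -/
theorem BranchDecomposition.built_univ [Nonempty V] (D : BranchDecomposition V)
    (hP : ∀ a b, D.tree.Adj a b → P (D.side a b)) (hu : P Set.univ) : Built P Set.univ := by
  obtain ⟨v₀⟩ := ‹Nonempty V›
  obtain ⟨a, ha⟩ : ∃ a, a = D.leafEquiv.symm v₀ := ⟨_, rfl⟩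
  have hv₀ : ∀ v, (D.leafEquiv.symm v : D.Node) = a ↔ v = v₀ := fun v => by
    rw [← Subtype.ext_iff, ha]
    exact D.leafEquiv.symm.injective.eq_iff
  by_cases hN : ∃ b, D.tree.Adj a b
  · obtain ⟨b, hab⟩ := hN
    have heq : D.side a b = {v₀} := by
      ext v
      rw [D.mem_side, mem_branch_iff D.isTree hab, hv₀, Set.mem_singleton_iff]
      refine or_iff_left ?_
      rintro ⟨c, hac, hcb, -⟩
      exact hcb (Set.encard_le_one_iff.1 a.2 _ _ hac hab)
    have h1 := D.built_side hP a b hab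
    have h2 := D.built_side hP b a hab.symm
    have hc : D.side b a = (D.side a b)ᶜ := by
      ext v
      rw [D.mem_side, ← branch_compl D.isTree hab]
      rfl
    rw [← Set.union_compl_self (D.side a b), ← hc] at hu ⊢
    exact h1.union h2 (hc ▸ disjoint_compl_right) hu
  · push Not at hN
    have heq : Set.univ = ({v₀} : Set V) := by
      ext v
      simp only [Set.mem_univ, Set.mem_singleton_iff, true_iff]
      by_contra hv
      obtain ⟨c, hc, -⟩ := exists_mem_branch D.isTree fun h => hv ((hv₀ v).1 h)
      exact hN c hc
    rw [heq] at hu ⊢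
    exact .singleton _ hu

end BranchDecomposition

/-! ### Few neighbourhoods across a cut of small split-matching number -/

section Types

variable {V : Type u} {G : SimpleGraph V} {A : Set V}

theorem encard_inter_verts_le {H : SimpleGraph V} {M : H.Subgraph} (hM : M.IsMatching) {B : Set V}
    (hB : ∀ u ∈ B, ∀ v ∈ B, ¬ H.Adj u v) : (M.verts ∩ B).encard ≤ M.edgeSet.encard := by
  let f : ↥(M.verts ∩ B) → M.edgeSet := fun v => hM.toEdge ⟨v.1, v.2.1⟩
  refine ENat.card_le_card_of_injective (f := f) ?_
  rintro ⟨u, hu, huB⟩ ⟨v, hv, hvB⟩ huv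
  by_contra hne
  have h1 : u ∈ (f ⟨u, hu, huB⟩ : Sym2 V) := hM.mem_coe_toEdge hu
  have h2 : v ∈ (f ⟨u, hu, huB⟩ : Sym2 V) := by rw [huv]; exact hM.mem_coe_toEdge hv
  have he := (Sym2.mem_and_mem_iff (fun h => hne (Subtype.ext h))).1 ⟨h1, h2⟩
  have hadj : M.Adj u v := by
    rw [← SimpleGraph.Subgraph.mem_edgeSet, ← he]
    exact (f ⟨u, hu, huB⟩).2
  exact hB u huB v hvB hadj.adj_sub

/-- The vertices of an inclusion-maximal matching meet every crossing edge, and each matching edge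
has one end on each side. -/
theorem exists_cover_of_mm_le [Finite V] {k : ℕ} (h : mm G A ≤ k) :
    ∃ W : Set V, (W ∩ A).encard ≤ k ∧ (W ∩ Aᶜ).encard ≤ k ∧
      ∀ u ∈ A, ∀ v ∈ Aᶜ, G.Adj u v → u ∈ W ∨ v ∈ W := by
  have hfin : {M : (G.between A Aᶜ).Subgraph | M.IsMatching}.Finite := Set.toFinite _
  obtain ⟨M, hM, hmax⟩ := hfin.exists_maximal ⟨⊥, fun _ h => h.elim⟩
  have hMk : M.edgeSet.encard ≤ k := (le_iSup₂_of_le M hM le_rfl).trans h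
  refine ⟨M.verts, (encard_inter_verts_le hM ?_).trans hMk,
    (encard_inter_verts_le hM ?_).trans hMk, fun u hu v hv huv => ?_⟩
  · rintro u hu v hv ⟨-, ⟨-, h⟩ | ⟨h, -⟩⟩
    · exact h hv
    · exact h hu
  · rintro u hu v hv ⟨-, ⟨h, -⟩ | ⟨-, h⟩⟩
    · exact hu h
    · exact hv h
  · by_contra! hn
    have hadj : (G.between A Aᶜ).Adj u v := ⟨huv, .inl ⟨hu, hv⟩⟩
    have hsup : (M ⊔ (G.between A Aᶜ).subgraphOfAdj hadj).IsMatching := by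
      refine hM.sup (SimpleGraph.Subgraph.IsMatching.subgraphOfAdj hadj) ?_
      rw [Set.disjoint_left]
      intro x hx hx'
      have hx := M.support_subset_verts hx
      have hx' := SimpleGraph.Subgraph.support_subset_verts _ hx'
      rw [SimpleGraph.subgraphOfAdj_verts] at hx'
      rcases hx' with rfl | rfl
      · exact hn.1 hx
      · exact hn.2 hx
    have := hmax hsup le_sup_left
    exact hn.1 (this.1 (.inr (by simp)))

/-- The neighbourhoods in the complement of `A` of the vertices of `A`. -/
def traces (G : SimpleGraph V) (A : Set V) : Set (Set V) :=
  (fun v => G.neighborSet v ∩ Aᶜ) '' A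

/-- Covering vertices in `A` contribute at most `k` traces; any other vertex of `A` has its trace
inside the at most `k` covering vertices of `Aᶜ`. -/
theorem encard_traces_le_of_mm_le [Finite V] {k : ℕ} (h : mm G A ≤ k) :
    (traces G A).encard ≤ (k + 2 ^ k : ℕ) := by
  obtain ⟨W, h1, h2, hW⟩ := exists_cover_of_mm_le h
  have hsub : traces G A ⊆ (fun v => G.neighborSet v ∩ Aᶜ) '' (W ∩ A) ∪ 𝒫 (W ∩ Aᶜ) := by
    rintro _ ⟨v, hv, rfl⟩
    by_cases hvW : v ∈ W
    · exact .inl ⟨v, ⟨hvW, hv⟩, rfl⟩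
    · exact .inr fun w hw => ⟨(hW v hv w hw.2 hw.1).resolve_left hvW, hw.2⟩
  have h2' : (𝒫 (W ∩ Aᶜ)).encard ≤ (2 ^ k : ℕ) := by
    have hf : (W ∩ Aᶜ).Finite := Set.toFinite _
    rw [← (Set.toFinite (𝒫 (W ∩ Aᶜ))).cast_ncard_eq, Set.ncard_powerset _ hf,
      ENat.natCast_le_natCast]
    refine Nat.pow_le_pow_right (by norm_num) ?_
    rwa [← ENat.natCast_le_natCast, hf.cast_ncard_eq]
  calc _ ≤ _ := Set.encard_le_encard hsub
    _ ≤ _ := Set.encard_union_le _ _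
    _ ≤ (k : ℕ∞) + (2 ^ k : ℕ) := add_le_add ((Set.encard_image_le _ _).trans h1) h2'
    _ = _ := by push_cast; rfl

theorem encard_traces_le_two_of_isSplit (h : IsSplit G A) : (traces G A).encard ≤ 2 := by
  obtain ⟨-, -, h⟩ := h
  have hsub : (traces G A \ {∅}).encard ≤ 1 := by
    rw [Set.encard_le_one_iff]
    rintro _ _ ⟨⟨u, hu, rfl⟩, hu'⟩ ⟨⟨v, hv, rfl⟩, hv'⟩
    exact h u hu v hv (Set.nonempty_iff_ne_empty.2 hu') (Set.nonempty_iff_ne_empty.2 hv')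
  calc (traces G A).encard ≤ (insert ∅ (traces G A \ {∅})).encard :=
        Set.encard_le_encard (by simp)
    _ ≤ (traces G A \ {∅}).encard + 1 := Set.encard_insert_le _ _
    _ ≤ 1 + 1 := by gcongr
    _ = 2 := by norm_num

theorem encard_traces_le_of_sm_le [Finite V] {k : ℕ} (h : sm G A ≤ k) :
    (traces G A).encard ≤ (k + 2 ^ k + 1 : ℕ) := by
  unfold sm at h
  split_ifs at h with hs
  · refine (encard_traces_le_two_of_isSplit hs).trans ?_
    -- The extra `1` in the bound makes room for the two traces of a split, uniformly in `k`.
    have : 1 ≤ 2 ^ k := Nat.one_le_two_pow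
    exact_mod_cast (by omega : 2 ≤ k + 2 ^ k + 1)
  · refine (encard_traces_le_of_mm_le h).trans ?_
    exact_mod_cast Nat.le_succ _

theorem traces_univ_encard_le : (traces G Set.univ).encard ≤ 1 := by
  rw [Set.encard_le_one_iff]
  rintro _ _ ⟨u, -, rfl⟩ ⟨v, -, rfl⟩
  simp

theorem exists_coloring_of_encard_traces_le {m : ℕ} (hm : 0 < m)
    (h : (traces G A).encard ≤ m) :
    ∃ c : V → Fin m, ∀ u ∈ A, ∀ v ∈ A,
      c u = c v ↔ G.neighborSet u ∩ Aᶜ = G.neighborSet v ∩ Aᶜ := by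
  classical
  have hfin : (traces G A).Finite := Set.finite_of_encard_le_coe h
  have := hfin.fintype
  have hcard : Fintype.card (traces G A) ≤ Fintype.card (Fin m) := by
    rwa [Fintype.card_fin, ← ENat.natCast_le_natCast, ← Set.toFinset_card,
      ← Set.encard_eq_coe_toFinset_card]
  obtain ⟨e⟩ := Function.Embedding.nonempty_of_card_le hcard
  refine ⟨fun v => if hv : v ∈ A then e ⟨_, v, hv, rfl⟩ else ⟨0, hm⟩, fun u hu v hv => ?_⟩
  simp only [hu, hv, dite_true, e.injective.eq_iff]
  exact Subtype.mk_eq_mk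

end Types

/-! ### Construction of labelled graphs by clique-width expressions -/

section CliqueWidth

variable {V : Type u} {k m : ℕ} {A B : Set V} {H H' : V → V → Prop} {ℓ ℓ' : V → Fin k}

/-- Some expression constructs, up to isomorphism, the graph on `A` with adjacency `H` and
labels `ℓ`. -/
def Constructs (A : Set V) (H : V → V → Prop) (ℓ : V → Fin k) : Prop :=
  ∃ (e : CliqueExpr k) (φ : e.Verts → V), Function.Injective φ ∧ Set.range φ = A ∧
    (∀ x y, e.graph.Adj x y ↔ H (φ x) (φ y)) ∧ ∀ x, e.label x = ℓ (φ x)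

theorem Constructs.congr (h : Constructs A H ℓ) (hH : ∀ u ∈ A, ∀ v ∈ A, H u v ↔ H' u v)
    (hℓ : ∀ u ∈ A, ℓ u = ℓ' u) : Constructs A H' ℓ' := by
  obtain ⟨e, φ, hφ, hA, hadj, hlab⟩ := h
  have hm : ∀ x, φ x ∈ A := fun x => hA ▸ ⟨x, rfl⟩
  exact ⟨e, φ, hφ, hA, fun x y => (hadj x y).trans (hH _ (hm x) _ (hm y)),
    fun x => (hlab x).trans (hℓ _ (hm x))⟩

theorem constructs_singleton (v : V) (ℓ : V → Fin k) :
    Constructs {v} (fun _ _ => False) ℓ :=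
  ⟨.vertex (ℓ v), fun _ => v, fun _ _ _ => rfl, by
    have : Nonempty (CliqueExpr.vertex (ℓ v)).Verts := ⟨()⟩
    exact Set.range_const, fun _ _ => Iff.rfl, fun _ => rfl⟩

theorem Constructs.union (hA : Constructs A H ℓ) (hB : Constructs B H ℓ) (hd : Disjoint A B) :
    Constructs (A ∪ B) (fun u v => H u v ∧ (u ∈ A ↔ v ∈ A)) ℓ := by
  obtain ⟨e₁, φ₁, hφ₁, rfl, hadj₁, hlab₁⟩ := hA
  obtain ⟨e₂, φ₂, hφ₂, rfl, hadj₂, hlab₂⟩ := hB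
  have hne : ∀ x y, φ₁ x ≠ φ₂ y := fun x y h => Set.disjoint_left.1 hd ⟨x, rfl⟩ ⟨y, h.symm⟩
  have hn : ∀ y, φ₂ y ∉ Set.range φ₁ := fun y ⟨x, hx⟩ => hne x y hx
  refine ⟨.union e₁ e₂, Sum.elim φ₁ φ₂, hφ₁.sumElim hφ₂ hne, Set.Sum.elim_range _ _, ?_, ?_⟩
  · rintro (x | x) (y | y)
    · exact (hadj₁ x y).trans (by simp)
    · exact iff_of_false (by simp [CliqueExpr.graph]) (by simp [hn])
    · exact iff_of_false (by simp [CliqueExpr.graph]) (by simp [hn])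
    · exact (hadj₂ x y).trans (by simp [hn])
  · rintro (x | x)
    · exact hlab₁ x
    · exact hlab₂ x

theorem Constructs.join (h : Constructs A H ℓ) {i j : Fin k} (hij : i ≠ j) :
    Constructs A (fun u v => H u v ∨ (ℓ u = i ∧ ℓ v = j) ∨ (ℓ v = i ∧ ℓ u = j)) ℓ := by
  obtain ⟨e, φ, hφ, hA, hadj, hlab⟩ := h
  have key : ∀ x y : e.Verts, (e.graph.Adj x y ∨ (x ≠ y ∧ ((e.label x = i ∧ e.label y = j) ∨
      (e.label y = i ∧ e.label x = j)))) ↔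
      (H (φ x) (φ y) ∨ (ℓ (φ x) = i ∧ ℓ (φ y) = j) ∨ (ℓ (φ y) = i ∧ ℓ (φ x) = j)) := by
    intro x y
    rw [hadj, hlab, hlab]
    refine or_congr_right (and_iff_right_of_imp ?_)
    rintro (⟨h1, h2⟩ | ⟨h1, h2⟩) rfl
    · exact hij (h1.symm.trans h2)
    · exact hij (h1.symm.trans h2)
  exact ⟨.join i j hij e, φ, hφ, hA, key, hlab⟩

theorem Constructs.joins (h : Constructs A H ℓ) {J : Set (Fin k × Fin k)}
    (hJ : ∀ p ∈ J, p.1 ≠ p.2) :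
    Constructs A (fun u v => H u v ∨ (ℓ u, ℓ v) ∈ J ∨ (ℓ v, ℓ u) ∈ J) ℓ := by
  induction J, J.toFinite using Set.Finite.induction_on with
  | empty => exact h.congr (by simp) fun _ _ => rfl
  | @insert p J _ _ ih =>
    refine ((ih fun q hq => hJ q (.inr hq)).join (hJ p (.inl rfl))).congr (fun u _ v _ => ?_)
      fun _ _ => rfl
    simp only [Set.mem_insert_iff, Prod.ext_iff]
    tauto

-- Relabellings happen one after another; as `f` maps `I` outside `I`, no vertex is relabelled
-- twice.
open Classical in
theorem Constructs.relabels (h : Constructs A H ℓ) {I : Set (Fin k)} {f : Fin k → Fin k}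
    (hf : ∀ i ∈ I, f i ∉ I) :
    Constructs A H (fun v => if ℓ v ∈ I then f (ℓ v) else ℓ v) := by
  suffices H : ∀ J ⊆ I, Constructs A H (fun v => if ℓ v ∈ J then f (ℓ v) else ℓ v) from
    H I subset_rfl
  intro J
  induction J, J.toFinite using Set.Finite.induction_on with
  | empty => exact fun _ => h.congr (fun _ _ _ _ => Iff.rfl) (by simp)
  | @insert i J hi _ ih =>
    intro hJ
    obtain ⟨e, φ, hφ, hA, hadj, hlab⟩ := ih ((Set.subset_insert i J).trans hJ)
    have key : ∀ x : e.Verts, (if e.label x = i then f i else e.label x) =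
        if ℓ (φ x) ∈ insert i J then f (ℓ (φ x)) else ℓ (φ x) := by
      intro x
      rw [hlab]
      by_cases h1 : ℓ (φ x) ∈ J
      · have h2 : f (ℓ (φ x)) ≠ i := fun h => hf _ (hJ (.inr h1)) (h ▸ hJ (.inl rfl))
        simp [h1, h2]
      · by_cases h2 : ℓ (φ x) = i
        · simp [h2, hi]
        · simp [h1, h2]
    refine ⟨.relabel i (f i) e, φ, hφ, hA, hadj, fun x => (key x).trans ?_⟩
    congr

theorem Constructs.cliqueWidth_le {G : SimpleGraph V} (h : Constructs Set.univ G.Adj ℓ) :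
    cliqueWidth G ≤ k := by
  obtain ⟨e, φ, hφ, hA, hadj, -⟩ := h
  exact iInf₂_le k ⟨e, ⟨⟨Equiv.ofBijective φ ⟨hφ, Set.range_eq_univ.1 hA⟩, (hadj _ _).symm⟩⟩⟩

/-- The label numbered `i` in the block `b` of labels. -/
def blockLabel (b : Fin 3) (i : Fin m) : Fin (3 * m) := finProdFinEquiv (b, i)

@[simp]
theorem blockLabel_inj {b b' : Fin 3} {i i' : Fin m} :
    blockLabel b i = blockLabel b' i' ↔ b = b' ∧ i = i' := by
  simp [blockLabel]

/-- Labels can be moved from some blocks to another block. -/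
theorem Constructs.moveBlock {p : V → Fin 3 × Fin m}
    (h : Constructs A H fun v => blockLabel (p v).1 (p v).2) {b : Fin 3}
    (hb : ∀ v ∈ A, (p v).1 ≠ b) (c : V → Fin m)
    (hc : ∀ u ∈ A, ∀ v ∈ A, p u = p v → c u = c v) :
    Constructs A H fun v => blockLabel b (c v) := by
  classical
  have hex : ∃ f : Fin (3 * m) → Fin (3 * m), ∀ v ∈ A,
      f (blockLabel (p v).1 (p v).2) = blockLabel b (c v) := by
    refine ⟨fun i => if h : ∃ v ∈ A, blockLabel (p v).1 (p v).2 = i then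
      blockLabel b (c h.choose) else i, fun v hv => ?_⟩
    have hv' : ∃ w ∈ A, blockLabel (p w).1 (p w).2 = blockLabel (p v).1 (p v).2 := ⟨v, hv, rfl⟩
    have hs := hv'.choose_spec
    refine (dif_pos hv').trans (blockLabel_inj.2 ⟨rfl, hc _ hs.1 v hv ?_⟩)
    exact Prod.ext_iff.2 (blockLabel_inj.1 hs.2)
  obtain ⟨f, hf⟩ := hex
  refine (h.relabels (I := (fun v => blockLabel (p v).1 (p v).2) '' A) (f := f) ?_).congr
    (fun _ _ _ _ => Iff.rfl) fun v hv => ?_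
  · rintro _ ⟨v, hv, rfl⟩ ⟨w, hw, h⟩
    dsimp only at h
    rw [hf v hv, blockLabel_inj] at h
    exact hb w hw h.1
  · rw [if_pos ⟨v, hv, rfl⟩, hf v hv]

/-- Keep `S` in block `0`, move `T` to block `1`, and join across. The new classes go to block `2`,
which is still unused, and then back to block `0` to restore the invariant. -/
theorem constructs_of_built {G : SimpleGraph V} (hm : 0 < m)
    (h : Built (fun X => (traces G X).encard ≤ m) A) :
    ∃ c : V → Fin m,
      (∀ u ∈ A, ∀ v ∈ A, c u = c v ↔ G.neighborSet u ∩ Aᶜ = G.neighborSet v ∩ Aᶜ) ∧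
        Constructs A G.Adj fun v => blockLabel 0 (c v) := by
  classical
  induction h with
  | singleton v hv =>
    obtain ⟨c, hc⟩ := exists_coloring_of_encard_traces_le hm hv
    refine ⟨c, hc, (constructs_singleton v _).congr ?_ fun _ _ => rfl⟩
    rintro _ rfl _ rfl
    simp
  | @union S T _ _ hd hP ih₁ ih₂ =>
    obtain ⟨c, hc⟩ := exists_coloring_of_encard_traces_le hm hP
    obtain ⟨c₁, hc₁, h₁⟩ := ih₁
    obtain ⟨c₂, hc₂, h₂⟩ := ih₂
    refine ⟨c, hc, ?_⟩
    have hTS : ∀ v ∈ T, v ∉ S := fun v hT hS => Set.disjoint_left.1 hd hS hT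
    have hST : ∀ v ∈ S, v ∉ T := fun v hS hT => Set.disjoint_left.1 hd hS hT
    let p : V → Fin 3 × Fin m := fun v => if v ∈ S then (0, c₁ v) else (1, c₂ v)
    have hpS : ∀ v ∈ S, p v = (0, c₁ v) := fun v hv => if_pos hv
    have hpT : ∀ v ∈ T, p v = (1, c₂ v) := fun v hv => if_neg (hTS v hv)
    have h₂' : Constructs T G.Adj fun v => blockLabel 1 (c₂ v) :=
      Constructs.moveBlock (p := fun v => (0, c₂ v)) h₂ (by simp) c₂
        fun u _ v _ h => (Prod.ext_iff.1 h).2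
    have h₁p := h₁.congr (ℓ' := fun v => blockLabel (p v).1 (p v).2) (fun _ _ _ _ => Iff.rfl)
      fun v hv => by rw [hpS v hv]
    have h₂p := h₂'.congr (ℓ' := fun v => blockLabel (p v).1 (p v).2) (fun _ _ _ _ => Iff.rfl)
      fun v hv => by rw [hpT v hv]
    -- Since `v'` lies outside `S`, equal traces allow `u'` to be replaced by `u`; then `v'` is
    -- replaced by `v`. So a join adds only edges of `G`.
    have hadj : ∀ u ∈ S, ∀ v ∈ T, ∀ u' ∈ S, ∀ v' ∈ T, c₁ u' = c₁ u → c₂ v' = c₂ v →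
        G.Adj u' v' → G.Adj u v := by
      intro u hu v hv u' hu' v' hv' hcu hcv hadj
      have e1 := (hc₁ u' hu' u hu).1 hcu
      have e2 := (hc₂ v' hv' v hv).1 hcv
      have a1 : v' ∈ G.neighborSet u ∩ Sᶜ := e1 ▸ ⟨hadj, hTS v' hv'⟩
      have a2 : u ∈ G.neighborSet v ∩ Tᶜ := e2 ▸ ⟨a1.1.symm, hST u hu⟩
      exact a2.1.symm
    obtain ⟨J, hJ⟩ : ∃ J : Set (Fin (3 * m) × Fin (3 * m)), J = {q | ∃ u ∈ S, ∃ v ∈ T,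
      G.Adj u v ∧ q = (blockLabel 0 (c₁ u), blockLabel 1 (c₂ v))} := ⟨_, rfl⟩
    have hJ₁ : ∀ i j, (blockLabel 0 i, blockLabel 1 j) ∈ J ↔
        ∃ u ∈ S, ∃ v ∈ T, G.Adj u v ∧ i = c₁ u ∧ j = c₂ v := by simp [hJ]
    have hJ₂ : ∀ (b b' : Fin 3) (i j : Fin m), (b ≠ 0 ∨ b' ≠ 1) →
        (blockLabel b i, blockLabel b' j) ∉ J := by
      rintro b b' i j hb h
      simp only [hJ, Set.mem_ofPred, Prod.mk.injEq, blockLabel_inj] at h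
      obtain ⟨_, _, _, _, _, ⟨h1, _⟩, h2, _⟩ := h
      exact hb.elim (fun h => h h1) fun h => h h2
    have hJST : ∀ u ∈ S, ∀ v ∈ T, (blockLabel 0 (c₁ u), blockLabel 1 (c₂ v)) ∈ J ↔ G.Adj u v := by
      intro u hu v hv
      rw [hJ₁]
      constructor
      · rintro ⟨u', hu', v', hv', h, h1, h2⟩
        exact hadj u hu v hv u' hu' v' hv' h1.symm h2.symm h
      · exact fun h => ⟨u, hu, v, hv, h, rfl, rfl⟩
    have h₃ := (h₁p.union h₂p hd).joins (J := J)
      (by rw [hJ]; rintro _ ⟨u, -, v, -, -, rfl⟩; simp)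
    have h₄ : Constructs (S ∪ T) G.Adj fun v => blockLabel (p v).1 (p v).2 := by
      refine h₃.congr (fun u hu v hv => ?_) fun _ _ => rfl
      rcases hu with hu | hu <;> rcases hv with hv | hv
      · simp [hpS u hu, hpS v hv, hu, hv, hJ₂]
      · simp [hpS u hu, hpT v hv, hu, hTS v hv, hJ₂, hJST u hu v hv]
      · simp [hpS v hv, hpT u hu, hv, hTS u hu, hJ₂, hJST v hv u hu, G.adj_comm]
      · simp [hpT u hu, hpT v hv, hTS u hu, hTS v hv, hJ₂]
    have h₅ : Constructs (S ∪ T) G.Adj fun v => blockLabel 2 (c v) := by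
      refine h₄.moveBlock ?_ c ?_
      · rintro v (hv | hv)
        · simp [hpS v hv]
        · simp [hpT v hv]
      -- Enlarging the set only shrinks its complement, so equal old traces give equal new ones.
      · have hsub : ∀ {X : Set V}, X ⊆ S ∪ T → ∀ {u v}, G.neighborSet u ∩ Xᶜ =
            G.neighborSet v ∩ Xᶜ → G.neighborSet u ∩ (S ∪ T)ᶜ = G.neighborSet v ∩ (S ∪ T)ᶜ := by
          intro X hX u v huv
          ext w
          have := Set.ext_iff.1 huv w
          simp only [Set.mem_inter_iff] at this ⊢
          have hw : w ∈ (S ∪ T)ᶜ → w ∈ Xᶜ := fun h h' => h (hX h')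
          tauto
        rintro u (hu | hu) v (hv | hv) huv
        · rw [hpS u hu, hpS v hv] at huv
          exact (hc u (.inl hu) v (.inl hv)).2
            (hsub Set.subset_union_left ((hc₁ u hu v hv).1 (Prod.ext_iff.1 huv).2))
        · simp [hpS u hu, hpT v hv] at huv
        · simp [hpT u hu, hpS v hv] at huv
        · rw [hpT u hu, hpT v hv] at huv
          exact (hc u (.inr hu) v (.inr hv)).2
            (hsub Set.subset_union_right ((hc₂ u hu v hv).1 (Prod.ext_iff.1 huv).2))
    exact Constructs.moveBlock (p := fun v => (2, c v)) h₅ (by simp) c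
      fun u _ v _ h => (Prod.ext_iff.1 h).2

theorem cliqueWidth_le_of_smw_le [Finite V] [Nonempty V] {G : SimpleGraph V} {k : ℕ}
    (h : smw G ≤ k) : cliqueWidth G ≤ (3 * (k + 2 ^ k + 1) : ℕ) := by
  -- The infimum is attained: widths all exceeding `k` would be at least `k + 1`.
  have hex : ∃ D : BranchDecomposition V, D.width (sm G) ≤ k := by
    by_contra! hn
    have : ((k + 1 : ℕ) : ℕ∞) ≤ smw G := le_iInf fun D => by
      simpa using Order.add_one_le_of_lt (hn D)
    exact absurd (ENat.natCast_le_natCast.1 (this.trans h)) (by simp)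
  obtain ⟨D, hD⟩ := hex
  have hb : Built (fun X => (traces G X).encard ≤ (k + 2 ^ k + 1 : ℕ)) Set.univ := by
    refine D.built_univ (fun a b hab => encard_traces_le_of_sm_le (le_trans ?_ hD)) ?_
    · exact le_iSup_of_le a (le_iSup_of_le b (le_iSup_of_le hab le_rfl))
    · exact traces_univ_encard_le.trans (by exact_mod_cast Nat.le_add_left 1 _)
  obtain ⟨c, -, hc⟩ := constructs_of_built (Nat.succ_pos _) hb
  exact hc.cliqueWidth_le

end CliqueWidth

end SmWidth

theorem mainTheorem10 :
    (∀ (V : Type u) [Finite V] [Nonempty V] (G : SimpleGraph V),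
      SmWidth.smw G ≤ SmWidth.treewidth G + 1) ∧
    (∀ 𝒢 : (V : Type u) → SimpleGraph V → Prop,
      SmWidth.BoundedOn (fun _ G => SmWidth.treewidth G) 𝒢 →
        SmWidth.BoundedOn (fun _ G => SmWidth.smw G) 𝒢) ∧
    (∀ 𝒢 : (V : Type u) → SimpleGraph V → Prop,
      SmWidth.BoundedOn (fun _ G => SmWidth.smw G) 𝒢 →
        SmWidth.BoundedOn (fun _ G => SmWidth.cliqueWidth G) 𝒢) := by
  refine ⟨fun V _ _ G => SmWidth.smw_le_treewidth_add_one G, ?_, ?_⟩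
  · rintro 𝒢 ⟨k, hk⟩
    refine ⟨k + 1, fun V _ _ G hG => (SmWidth.smw_le_treewidth_add_one G).trans ?_⟩
    push_cast
    gcongr
    exact hk V G hG
  · rintro 𝒢 ⟨k, hk⟩
    exact ⟨_, fun V _ _ G hG => SmWidth.cliqueWidth_le_of_smw_le (hk V G hG)⟩
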